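/- Let $X$ be a set, let $\mathcal A,\mathcal B$ be unital $C^*$-algebras, and let $\mathcal L(\mathcal A,\mathcal B)$ be the space of bounded linear maps from $\mathcal A$ to $\mathcal B$. A kernel is a map $k:X\times X\to\mathcal L(\mathcal A,\mathcal B)$, and its adjoint is the kernel $k^*(x,y)[a]=(k(y,x)[a^*])^*$. A kernel $k$ is *completely positive* if $\sum_{i,j=1}^n b_i^*\,k(x_i,x_j)[a_i^*a_j]\,b_j\ge 0$ for every finite choice of $(x_i,a_i,b_i)\in X\times\mathcal A\times\mathcal B$, $i=1,\dots,n$. It is *completely bounded* if for every finite subset $\{x_1,\dots,x_n\}$ of $X$ the entrywise map $(k(x_i,x_j)):M_n(\mathcal A)\to M_n(\mathcal B)$, $(a_{ij})\mapsto (k(x_i,x_j)[a_{ij}])$, is completely bounded. It *has a Kolmogorov decomposition* if there are an $(\mathcal A,\mathcal B)$-correspondence $E$ (a right Hilbert $\mathcal B$-module with a unital $*$-homomorphism from $\mathcal A$ to its adjointable operators), an adjointable contractive left $\mathcal A$-module map $J:E\to E$, and a map $\iota:X\to E$ such that $$k(x,y)[a]=\langle a\cdot\iota(y),\,J(\iota(x))\rangle\qquad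 (x,y\in X,\ a\in\mathcal A),$$ where the $\mathcal B$-valued inner product is linear in the first variable. **Corollary.** A kernel $k:X\times X\to\mathcal L(\mathcal A,\mathcal B)$ has a Kolmogorov decomposition if and only if there exist completely positive kernels $L_1,L_2:X\times X\to\mathcal L(\mathcal A,\mathcal B)$ such that $$(x,y)\mapsto\begin{pmatrix} L_1(x,y)&k(x,y)\\ k^*(x,y)&L_2(x,y)\end{pmatrix}:M_2(\mathcal A)\to M_2(\mathcal B),$$ acting entrywise (as a Schur product), i.e. $$\begin{pmatrix} a_{11}&a_{12}\\a_{21}&a_{22}\end{pmatrix}\mapsto\begin{pmatrix} L_1(x,y)[a_{11}]&k(x,y)[a_{12}]\\ k^*(x,y)[a_{21}]&L_2(x,y)[a_{22}]\end{pmatrix},$$ is a completely positive kernel with values in $\mathcal L(M_2(\mathcal A),M_2(\mathcal B))$. In this case, $k$ is a completely bounded kernel and is a linear combination, with complex coefficients, of at most four completely positive kernels. -/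

import Mathlib

namespace CKernel

universe uX uA uB w

/-- Kernels on `X` with values in the bounded linear maps from `A` to `B`. -/
abbrev Kernel (X : Type uX) (A : Type uA) (B : Type uB) [CStarAlgebra A] [CStarAlgebra B] :
    Type (max uX uA uB) :=
  X → X → A →L[ℂ] B

section Basic

variable {X : Type uX} {A : Type uA} {B : Type uB} [CStarAlgebra A] [CStarAlgebra B]

/-- The adjoint kernel: `k* (x, y) [a] = (k (y, x) [a*])*`. -/
noncomputable def adjoint (k : Kernel X A B) : Kernel X A B := fun x y =>
  ((starL ℂ : B ≃L⋆[ℂ] B) : B →L⋆[ℂ] B).comp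
    ((k y x).comp ((starL ℂ : A ≃L⋆[ℂ] A) : A →L⋆[ℂ] A))

theorem adjoint_apply (k : Kernel X A B) (x y : X) (a : A) :
    adjoint k x y a = star (k y x (star a)) := rfl

/-- Complete positivity: `∑ i j, bᵢ* k(xᵢ, xⱼ)[aᵢ* aⱼ] bⱼ ≥ 0` for all finite choices of
`(xᵢ, aᵢ, bᵢ)`. -/
def IsCompletelyPositive [PartialOrder B] (k : Kernel X A B) : Prop :=
  ∀ (n : ℕ) (x : Fin n → X) (a : Fin n → A) (b : Fin n → B),
    0 ≤ ∑ i, ∑ j, star (b i) * k (x i) (x j) (star (a i) * a j) * b j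

end Basic

section Matrix

variable {X : Type uX} {A : Type uA} {B : Type uB}
  [CStarAlgebra A] [PartialOrder A] [StarOrderedRing A]
  [CStarAlgebra B] [PartialOrder B] [StarOrderedRing B]

/-- The entrywise (Schur product) action of a matrix of bounded linear maps:
`(aᵢⱼ) ↦ (φᵢⱼ[aᵢⱼ])` as a map from `Mₙ(A)` to `Mₙ(B)`. -/
noncomputable def schurMap {n : ℕ} (φ : Matrix (Fin n) (Fin n) (A →L[ℂ] B)) :
    CStarMatrix (Fin n) (Fin n) A →L[ℂ] CStarMatrix (Fin n) (Fin n) B where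
  toFun M := CStarMatrix.ofMatrix (Matrix.of fun i j => φ i j (M i j))
  map_add' M N := by
    ext i j
    exact map_add (φ i j) (M i j) (N i j)
  map_smul' c M := by
    ext i j
    exact map_smul (φ i j) c (M i j)
  cont := by
    refine continuous_pi fun i => continuous_pi fun j => (φ i j).continuous.comp ?_
    exact (continuous_apply j).comp (continuous_apply i)

/-- The `2 × 2` matrix of kernels `[[L₁, k], [k*, L₂]]`, acting at each point of `X × X` as a
Schur product, as a kernel with values in the bounded linear maps from `M₂(A)` to `M₂(B)`. -/
noncomputable def schurKernel (L₁ L₂ k : Kernel X A B) :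
    Kernel X (CStarMatrix (Fin 2) (Fin 2) A) (CStarMatrix (Fin 2) (Fin 2) B) := fun x y =>
  schurMap !![L₁ x y, k x y; adjoint k x y, L₂ x y]

/-- A bounded linear map is completely bounded if its amplifications to `m × m` matrices are
bounded uniformly in `m`. -/
def IsCompletelyBoundedMap (φ : A →L[ℂ] B) : Prop :=
  ∃ C : ℝ, ∀ (m : ℕ) (M : CStarMatrix (Fin m) (Fin m) A), ‖M.map φ‖ ≤ C * ‖M‖

/-- A kernel is completely bounded if for each finite subset `{x₁, …, xₙ}` of `X` the entrywise
map `(k(xᵢ, xⱼ)) : Mₙ(A) → Mₙ(B)` is completely bounded. -/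
def IsCompletelyBounded (k : Kernel X A B) : Prop :=
  ∀ (n : ℕ) (x : Fin n → X), Function.Injective x →
    IsCompletelyBoundedMap (schurMap (Matrix.of fun i j => k (x i) (x j)))

end Matrix

section Correspondence

/-- An `(A, B)`-correspondence: a (complete) right Hilbert `B`-module with a unital
`*`-homomorphism from `A` to its adjointable operators.

`CStarModule` has its inner product linear over a left action. A right Hilbert `B`-module is
therefore a `CStarModule` over the opposite algebra `Bᵐᵒᵖ`. The `B`-valued inner product is
`Correspondence.ip` below. -/
structure Correspondence (A : Type uA) (B : Type uB) [CStarAlgebra A]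
    [CStarAlgebra B] [PartialOrder B] where
  carrier : Type w
  [normedAddCommGroup : NormedAddCommGroup carrier]
  [normedSpace : NormedSpace ℂ carrier]
  [completeSpace : CompleteSpace carrier]
  [module : Module Bᵐᵒᵖ carrier]
  [cstarModule : CStarModule Bᵐᵒᵖ carrier]
  lact : A →ₐ[ℂ] (carrier →L[ℂ] carrier)
  inner_lact : ∀ (a : A) (e f : carrier),
    inner Bᵐᵒᵖ (lact (star a) e) f = inner Bᵐᵒᵖ e (lact a f)

attribute [instance] Correspondence.normedAddCommGroup Correspondence.normedSpace
  Correspondence.completeSpace Correspondence.module Correspondence.cstarModule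

namespace Correspondence

variable {A : Type uA} {B : Type uB} [CStarAlgebra A] [CStarAlgebra B] [PartialOrder B]

/-- The `B`-valued inner product, `B`-linear in the FIRST variable:
`⟨e · b, f⟩ = ⟨e, f⟩ b` and `⟨e, f · b⟩ = b* ⟨e, f⟩`. -/
def ip (E : Correspondence.{uA, uB, w} A B) (e f : E.carrier) : B :=
  MulOpposite.unop (inner Bᵐᵒᵖ f e)

theorem ip_smul_left (E : Correspondence.{uA, uB, w} A B) (e f : E.carrier) (b : B) :
    E.ip (MulOpposite.op b • e) f = E.ip e f * b := by
  simp [ip]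

theorem ip_smul_right [StarOrderedRing B] (E : Correspondence.{uA, uB, w} A B)
    (e f : E.carrier) (b : B) :
    E.ip e (MulOpposite.op b • f) = star b * E.ip e f := by
  simp [ip]

/-- `J` is adjointable: there is a `J'` with `⟨J e, f⟩ = ⟨e, J' f⟩`. -/
def IsAdjointable (E : Correspondence.{uA, uB, w} A B)
    (J : E.carrier →L[ℂ] E.carrier) : Prop :=
  ∃ J' : E.carrier →L[ℂ] E.carrier, ∀ e f : E.carrier, E.ip (J e) f = E.ip e (J' f)

end Correspondence

variable {X : Type uX} {A : Type uA} {B : Type uB}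
  [CStarAlgebra A] [CStarAlgebra B] [PartialOrder B]

/-- `k` has a Kolmogorov decomposition: there are an `(A, B)`-correspondence `E`, an adjointable
contractive left `A`-module map `J` on `E`, and `ι : X → E` with
`k(x, y)[a] = ⟨a · ι(y), J (ι(x))⟩`. -/
def HasKolmogorovDecomposition (k : Kernel X A B) : Prop :=
  ∃ (E : Correspondence.{uA, uB, max uX uA uB} A B) (J : E.carrier →L[ℂ] E.carrier)
    (ι : X → E.carrier),
    E.IsAdjointable J ∧ ‖J‖ ≤ 1 ∧ (∀ (a : A) (e : E.carrier), J (E.lact a e) = E.lact a (J e)) ∧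
      ∀ (x y : X) (a : A), k x y a = E.ip (E.lact a (ι y)) (J (ι x))

end Correspondence

end CKernel

/-!
Write the `2 × 2` matrix of kernels as one scalar kernel `K` on `X × {0, 1}`
(`entryKernel`). Its complete positivity is equivalent to that of the Schur product kernel: matrices
supported in one row give one direction (`isCompletelyPositive_entryKernel`), and the general fact
that Schur products with a completely positive kernel are completely positive gives the other
(`IsCompletelyPositive.schur`). The latter rests on the criterion `nonneg_of_quad_nonneg`: a matrix
over a C⋆-algebra is positive when `c* M c ≥ 0` for all columns `c`.

Given a decomposition `(E, J, ι)` of `k`, the vectors `J (ι x)` and `ι x` of `E` define a completely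
positive kernel on `X × {0, 1}` whose corner at `(0, 1)` is `k`. Conversely, a completely positive
kernel on `X × {0, 1}` is of the form `⟨a · ξ(y, q), ξ(x, p)⟩` for vectors `ξ` of a correspondence
`E`, obtained by completing a module of formal sums `∑ (y, a) b` (`IsCompletelyPositive.gram`,
`SemiInner.Completion`). The corner at `(0, 1)` is then decomposed on `E ⊕ E` by
`ι(x) = (ξ(x, 0), ξ(x, 1))` and the shift `J(u, v) = (0, u)`
(`IsCompletelyPositive.hasKolmogorovDecomposition_corner`). The shift is a contraction commuting
with `A`, so no further structure of `E` is needed.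

Polarization in `E` writes `k` as a combination of four completely positive kernels
(`Correspondence.vectorKernel_eq_sum`). Complete boundedness follows: the Schur maps of a completely
positive kernel are completely positive, and a completely positive map `φ` is completely bounded,
since its amplifications are positive maps with value `diag(φ 1, …, φ 1)` at `1`
(`IsCompletelyPositive.isCompletelyBoundedMap`).
-/

namespace CKernel

universe uX uA uB w

/-! ### Semi-inner products with values in a C⋆-algebra -/

/-- Polarization: a sesquilinear map with self-adjoint diagonal values is Hermitian. -/
theorem star_sesquilinear_apply {B V : Type*} [CStarAlgebra B] [AddCommGroup V] [Module ℂ V]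
    (Q : V →ₗ⋆[ℂ] V →ₗ[ℂ] B) (hQ : ∀ x, star (Q x x) = Q x x) (x y : V) :
    star (Q x y) = Q y x := by
  have h₁ := hQ (x + y)
  have h₂ := hQ (x + Complex.I • y)
  simp only [map_add, LinearMap.add_apply, star_add, hQ, LinearMap.map_smulₛₗ,
    LinearMap.smul_apply, star_smul, RingHom.id_apply, Complex.conj_I, smul_add, smul_smul,
    Complex.star_def, map_neg, map_mul] at h₁ h₂
  have h₃ : star (Q y x) + star (Q x y) = Q y x + Q x y := by
    linear_combination (norm := module) h₁
  have h₄ : Complex.I • (star (Q y x) - star (Q x y)) = Complex.I • (Q x y - Q y x) := by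
    simp only [smul_sub]
    simp only [neg_smul, Complex.I_mul_I, neg_mul, mul_neg, neg_neg, one_smul] at h₂
    linear_combination (norm := module) h₂
  have h₅ := smul_right_injective B Complex.I_ne_zero h₄
  have h₆ : (2 : ℂ) • star (Q x y) = (2 : ℂ) • Q y x := by
    simp only [two_smul]
    linear_combination (norm := module) h₃ - h₅
  exact smul_right_injective B two_ne_zero h₆

/-- A possibly degenerate inner product on the `C`-module `V` with values in the C⋆-algebra `C`.
As in `CStarModule`, it is linear over `C` and over `ℂ` in the second variable. -/
structure SemiInner (C V : Type*) [CStarAlgebra C] [PartialOrder C] [AddCommGroup V] [Module ℂ V]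
    [Module C V] where
  form : V →ₗ⋆[ℂ] V →ₗ[ℂ] C
  form_smul_right : ∀ (c : C) (x y : V), form x (c • y) = c * form x y
  form_self_nonneg : ∀ x, 0 ≤ form x x

namespace SemiInner

variable {C V : Type*} [CStarAlgebra C] [PartialOrder C] [AddCommGroup V] [Module ℂ V]
  [Module C V] (S : SemiInner C V)

/-- A copy of `V` carrying the seminorm `x ↦ ‖⟪x, x⟫‖ ^ (1 / 2)` of the semi-inner product. -/
def Space (_ : SemiInner C V) : Type _ := V

noncomputable instance : AddCommGroup S.Space := inferInstanceAs (AddCommGroup V)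

noncomputable instance : Module ℂ S.Space := inferInstanceAs (Module ℂ V)

noncomputable instance : Module C S.Space := inferInstanceAs (Module C V)

noncomputable instance : Norm S.Space := ⟨fun x : V => √‖S.form x x‖⟩

/-- The identity map from `V` to its seminormed copy. -/
def toSpace : V ≃ₗ[ℂ] S.Space := LinearEquiv.refl ℂ V

theorem norm_toSpace (x : V) : ‖S.toSpace x‖ = √‖S.form x x‖ := rfl

theorem toSpace_smul (c : C) (x : V) : S.toSpace (c • x) = c • S.toSpace x := rfl

noncomputable instance : Inner C S.Space := ⟨fun x y : V => S.form x y⟩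

variable [StarOrderedRing C]

theorem star_form_self (x : V) : star (S.form x x) = S.form x x :=
  (IsSelfAdjoint.of_nonneg (S.form_self_nonneg x)).star_eq

/-- Hermitian symmetry is not part of the structure: it follows from positivity. -/
theorem star_form (x y : V) : star (S.form x y) = S.form y x :=
  star_sesquilinear_apply S.form S.star_form_self x y

theorem form_smul_left (c : C) (x y : V) : S.form (c • x) y = S.form x y * star c := by
  rw [← S.star_form, form_smul_right, star_mul, S.star_form]

/-- The real number `t` is kept strictly above `‖⟪x, x⟫‖` so that one may divide by it, although
`⟪x, x⟫` may vanish for `x ≠ 0`. -/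
theorem form_mul_form_le (x y : V) {t : ℝ} (ht : ‖S.form x x‖ < t) :
    S.form x y * S.form y x ≤ t • S.form y y := by
  have ht0 : 0 < t := (norm_nonneg _).trans_lt ht
  have h₀ := S.form_self_nonneg (S.form x y • x - (t : ℂ) • y)
  have h₁ : S.form x y * S.form x x * star (S.form x y) ≤ t • (S.form x y * star (S.form x y)) :=
    (CStarAlgebra.star_right_conjugate_le_norm_smul (S.star_form_self x)).trans
      (smul_le_smul_of_nonneg_right ht.le (mul_star_self_nonneg _))
  have h₂ : S.form (S.form x y • x - (t : ℂ) • y) (S.form x y • x - (t : ℂ) • y) =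
      S.form x y * S.form x x * star (S.form x y) - t • (S.form x y * S.form y x)
        - t • (S.form x y * S.form y x) + t • (t • S.form y y) := by
    simp only [map_sub, LinearMap.sub_apply, LinearMap.map_smulₛₗ, LinearMap.smul_apply,
      form_smul_right, form_smul_left, RingHom.id_apply, Complex.conj_ofReal, star_form,
      mul_assoc, smul_sub]
    simp only [Complex.coe_smul]
    abel
  rw [h₂, star_form] at h₀
  rw [star_form] at h₁
  have h₃ : t • (S.form x y * S.form y x) ≤ t • (t • S.form y y) := by
    rw [← sub_nonneg]
    refine (h₀.trans (add_le_add_left (sub_le_sub_right (sub_le_sub_right h₁ _) _) _)).trans_eq ?_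
    abel
  exact (smul_le_smul_iff_of_pos_left ht0).1 h₃

theorem norm_form_sq_le (x y : V) : ‖S.form x y‖ ^ 2 ≤ ‖S.form x x‖ * ‖S.form y y‖ := by
  have h : ∀ t, ‖S.form x x‖ < t → ‖S.form x y‖ ^ 2 ≤ t * ‖S.form y y‖ := fun t ht => by
    have h₁ := CStarAlgebra.norm_le_norm_of_nonneg_of_le
      (by rw [← S.star_form x y]; exact mul_star_self_nonneg _) (S.form_mul_form_le x y ht)
    rwa [norm_smul, Real.norm_of_nonneg ((norm_nonneg _).trans ht.le), ← S.star_form x y,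
      CStarRing.norm_self_mul_star, ← sq] at h₁
  have hc : Filter.Tendsto (fun t : ℝ => t * ‖S.form y y‖) 
      (nhdsWithin ‖S.form x x‖ (Set.Ioi ‖S.form x x‖))
      (nhds (‖S.form x x‖ * ‖S.form y y‖)) :=
    ((continuous_id.mul continuous_const).tendsto _).mono_left nhdsWithin_le_nhds
  exact ge_of_tendsto hc (Filter.eventually_of_mem self_mem_nhdsWithin fun t ht => h t ht)

theorem norm_form_le (x y : V) : ‖S.form x y‖ ≤ ‖S.toSpace x‖ * ‖S.toSpace y‖ := by
  rw [norm_toSpace, norm_toSpace, ← Real.sqrt_mul (norm_nonneg _)]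
  exact Real.le_sqrt_of_sq_le (S.norm_form_sq_le x y)

theorem seminormedCore : SeminormedSpace.Core ℂ S.Space where
  norm_nonneg x := Real.sqrt_nonneg _
  norm_smul c := S.toSpace.surjective.forall.2 fun x => by
    rw [← map_smul, norm_toSpace, norm_toSpace]
    simp only [LinearMap.map_smulₛₗ, LinearMap.smul_apply, map_smul, norm_smul, RCLike.norm_conj]
    rw [← mul_assoc, ← sq, Real.sqrt_mul (sq_nonneg _), Real.sqrt_sq (norm_nonneg _)]
  norm_triangle := S.toSpace.surjective.forall₂.2 fun x y => by
    have hx : ‖S.form x x‖ = ‖S.toSpace x‖ ^ 2 := (Real.sq_sqrt (norm_nonneg _)).symm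
    have hy : ‖S.form y y‖ = ‖S.toSpace y‖ ^ 2 := (Real.sq_sqrt (norm_nonneg _)).symm
    rw [← map_add, norm_toSpace]
    refine Real.sqrt_le_iff.2 ⟨add_nonneg (Real.sqrt_nonneg _) (Real.sqrt_nonneg _), ?_⟩
    simp only [map_add, LinearMap.add_apply]
    have h₁ := norm_add₄_le (a := S.form x x) (b := S.form y x) (c := S.form x y) (d := S.form y y)
    rw [← add_assoc]
    refine h₁.trans ?_
    rw [hx, hy]
    nlinarith [S.norm_form_le x y, S.norm_form_le y x]

noncomputable instance : SeminormedAddCommGroup S.Space := .ofCore S.seminormedCore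

noncomputable instance : NormedSpace ℂ S.Space where
  norm_smul_le c x := (S.seminormedCore.norm_smul c x).le

theorem norm_smul_toSpace_le (c : C) (x : S.Space) : ‖c • x‖ ≤ ‖c‖ * ‖x‖ := by
  obtain ⟨x, rfl⟩ := S.toSpace.surjective x
  rw [← toSpace_smul, norm_toSpace, norm_toSpace, ← Real.sqrt_sq (norm_nonneg c),
    ← Real.sqrt_mul (sq_nonneg _)]
  refine Real.sqrt_le_sqrt ?_
  rw [form_smul_right, form_smul_left]
  refine (norm_mul_le _ _).trans ((mul_le_mul_of_nonneg_left (norm_mul_le _ _)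
    (norm_nonneg _)).trans_eq ?_)
  rw [norm_star]
  ring

instance : UniformContinuousConstSMul C S.Space where
  uniformContinuous_const_smul c :=
    (AddMonoidHomClass.lipschitz_of_bound (DistribSMul.toAddMonoidHom S.Space c) ‖c‖
      (S.norm_smul_toSpace_le c)).uniformContinuous

theorem continuous_inner : Continuous fun p : S.Space × S.Space => inner C p.1 p.2 := by
  have : Continuous fun p : S.Space × S.Space =>
      LinearMap.mkContinuous₂ (S.form : S.Space →ₗ⋆[ℂ] S.Space →ₗ[ℂ] C) 1
        (fun x y => by rw [one_mul]; exact S.norm_form_le x y) p.1 p.2 := by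
    fun_prop
  exact this

/-! ### Completion to a Hilbert C⋆-module -/

open UniformSpace

/-- The Hilbert `C`-module obtained from `V` by dividing out the null vectors and completing. -/
abbrev Completion : Type _ := UniformSpace.Completion S.Space

/-- The canonical map of `V` onto a dense subspace of the completion. -/
noncomputable def toCompletion : V →ₗ[ℂ] S.Completion :=
  (UniformSpace.Completion.toComplL (𝕜 := ℂ) (E := S.Space)).toLinearMap ∘ₗ S.toSpace.toLinearMap

theorem denseRange_toCompletion : DenseRange S.toCompletion :=
  UniformSpace.Completion.denseRange_coe (α := S.Space)

theorem norm_toCompletion (x : V) : ‖S.toCompletion x‖ = √‖S.form x x‖ :=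
  UniformSpace.Completion.norm_coe (E := S.Space) _

theorem toCompletion_smul (c : C) (x : V) : S.toCompletion (c • x) = c • S.toCompletion x :=
  UniformSpace.Completion.coe_smul (X := S.Space) (M := C) c (S.toSpace x)

noncomputable instance : Inner C S.Completion := UniformSpace.Completion.toInner

theorem inner_toCompletion (x y : V) :
    inner C (S.toCompletion x) (S.toCompletion y) = S.form x y :=
  (Completion.isDenseInducing_coe.prodMap Completion.isDenseInducing_coe).extend_eq
    (f := Function.uncurry (inner C)) S.continuous_inner (S.toSpace x, S.toSpace y)

theorem continuous_completion_inner :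
    Continuous fun p : S.Completion × S.Completion => inner C p.1 p.2 := by
  let φ : S.Space →+ S.Space →+ C :=
    { toFun := fun x => (S.form x).toAddMonoidHom
      map_zero' := by ext x; exact LinearMap.congr_fun (map_zero S.form) x
      map_add' := fun x y => by ext z; exact LinearMap.congr_fun (map_add S.form x y) z }
  exact (Completion.isDenseInducing_toCompl S.Space).extend_Z_bilin
    (Completion.isDenseInducing_toCompl S.Space) (φ := φ) S.continuous_inner

@[fun_prop]
theorem _root_.Continuous.semiInner {T : Type*} [TopologicalSpace T] {f g : T → S.Completion}
    (hf : Continuous f) (hg : Continuous g) : Continuous fun t => inner C (f t) (g t) :=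
  S.continuous_completion_inner.comp (hf.prodMk hg)

theorem norm_eq_completion (x : S.Completion) : ‖x‖ = √‖inner C x x‖ :=
  S.denseRange_toCompletion.induction_on x (isClosed_eq (by fun_prop) (by fun_prop)) fun x => by
    rw [norm_toCompletion, inner_toCompletion]

noncomputable instance : CStarModule C S.Completion where
  inner_add_right {x y z} := by
    refine S.denseRange_toCompletion.induction_on₃
      (p := fun x y z => inner C x (y + z) = inner C x y + inner C x z)
      (isClosed_eq (by fun_prop) (by fun_prop)) (fun x y z => ?_) x y z
    simp only [← map_add, inner_toCompletion]
  inner_self_nonneg {x} :=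
    S.denseRange_toCompletion.induction_on x
      (CStarAlgebra.isClosed_nonneg.preimage (by fun_prop : Continuous fun x => inner C x x))
      fun x => by rw [inner_toCompletion]; exact S.form_self_nonneg x
  inner_self {x} := by
    rw [← norm_eq_zero (a := x), norm_eq_completion, Real.sqrt_eq_zero (norm_nonneg _),
      norm_eq_zero]
  inner_op_smul_right {c x y} := by
    refine S.denseRange_toCompletion.induction_on₂
      (p := fun x y => inner C x (c • y) = c * inner C x y)
      (isClosed_eq (S.continuous_completion_inner.comp
        (continuous_fst.prodMk (continuous_snd.const_smul c))) (by fun_prop)) (fun x y => ?_) x y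
    rw [← toCompletion_smul, inner_toCompletion, inner_toCompletion, form_smul_right]
  inner_smul_right_complex {c x y} := by
    refine S.denseRange_toCompletion.induction_on₂
      (p := fun x y => inner C x (c • y) = c • inner C x y)
      (isClosed_eq (S.continuous_completion_inner.comp
        (continuous_fst.prodMk (continuous_snd.const_smul c)))
        (S.continuous_completion_inner.const_smul c)) (fun x y => ?_) x y
    rw [← map_smul, inner_toCompletion, inner_toCompletion, map_smul]
  star_inner x y := by
    refine S.denseRange_toCompletion.induction_on₂
      (p := fun x y => star (inner C x y) = inner C y x)
      (isClosed_eq (by fun_prop) (by fun_prop)) (fun x y => ?_) x y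
    rw [inner_toCompletion, inner_toCompletion, star_form]
  norm_eq_sqrt_norm_inner_self := S.norm_eq_completion

end SemiInner

/-- A linear map that is positive on squares satisfies `‖φ (a* a)‖ ≤ ‖φ 1‖ ‖a‖ ^ 2`. -/
theorem norm_map_star_mul_self_le {A C : Type*} [CStarAlgebra A] [PartialOrder A]
    [StarOrderedRing A] [CStarAlgebra C] [PartialOrder C] [StarOrderedRing C] (φ : A →ₗ[ℂ] C)
    (hφ : ∀ r, 0 ≤ φ (star r * r)) (a : A) : ‖φ (star a * a)‖ ≤ ‖φ 1‖ * ‖a‖ ^ 2 := by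
  have hpos : ∀ x, 0 ≤ x → 0 ≤ φ x := fun x hx => by
    obtain ⟨r, rfl⟩ := CStarAlgebra.nonneg_iff_eq_star_mul_self.1 hx
    exact hφ r
  have h := (PositiveLinearMap.mk₀ φ hpos).norm_apply_le_of_nonneg _ (star_mul_self_nonneg a)
  rwa [CStarRing.norm_star_mul_self, ← sq] at h

namespace SemiInner

variable {C V : Type*} [CStarAlgebra C] [PartialOrder C] [StarOrderedRing C] [AddCommGroup V]
  [Module ℂ V] [Module C V] (S : SemiInner C V)

theorem toCompletion_eq_of_form_eq {x y : V} (h : ∀ z, S.form z x = S.form z y) :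
    S.toCompletion x = S.toCompletion y := by
  rw [← sub_eq_zero, ← map_sub, ← norm_eq_zero, norm_toCompletion, map_sub, h, sub_self, norm_zero,
    Real.sqrt_zero]

/-- The continuous extension to the completion of a linear map on `V`. It is meaningful when the
map is bounded for the seminorm of `S`. -/
noncomputable def extend (T : V →ₗ[ℂ] V) : S.Completion →L[ℂ] S.Completion :=
  (S.toCompletion ∘ₗ T).extendOfNorm S.toCompletion

variable {S}

theorem norm_toCompletion_le_of_form_le {T : V →ₗ[ℂ] V} {r : ℝ} (hr : 0 ≤ r)
    (hT : ∀ x, ‖S.form (T x) (T x)‖ ≤ ‖S.form x x‖ * r ^ 2) (x : V) :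
    ‖(S.toCompletion ∘ₗ T) x‖ ≤ r * ‖S.toCompletion x‖ := by
  rw [LinearMap.comp_apply, norm_toCompletion, norm_toCompletion, ← Real.sqrt_sq hr,
    ← Real.sqrt_mul (sq_nonneg _), mul_comm]
  exact Real.sqrt_le_sqrt (hT x)

theorem extend_toCompletion {T : V →ₗ[ℂ] V} {r : ℝ} (hr : 0 ≤ r)
    (hT : ∀ x, ‖S.form (T x) (T x)‖ ≤ ‖S.form x x‖ * r ^ 2) (x : V) :
    S.extend T (S.toCompletion x) = S.toCompletion (T x) :=
  LinearMap.extendOfNorm_eq S.denseRange_toCompletion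
    ⟨r, norm_toCompletion_le_of_form_le hr hT⟩ x

theorem norm_extend_le {T : V →ₗ[ℂ] V} {r : ℝ} (hr : 0 ≤ r)
    (hT : ∀ x, ‖S.form (T x) (T x)‖ ≤ ‖S.form x x‖ * r ^ 2) : ‖S.extend T‖ ≤ r :=
  LinearMap.opNorm_extendOfNorm_le S.denseRange_toCompletion hr
    (norm_toCompletion_le_of_form_le hr hT)

theorem clm_ext {T T' : S.Completion →L[ℂ] S.Completion}
    (h : ∀ x, T (S.toCompletion x) = T' (S.toCompletion x)) : T = T' :=
  ContinuousLinearMap.ext fun x =>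
    S.denseRange_toCompletion.induction_on x (isClosed_eq T.continuous T'.continuous) h

/-- An adjointness relation on `V` passes to the continuous extensions. -/
theorem inner_extend {T T' : V →ₗ[ℂ] V} {r : ℝ} (hr : 0 ≤ r)
    (hT : ∀ x, ‖S.form (T x) (T x)‖ ≤ ‖S.form x x‖ * r ^ 2)
    (hT' : ∀ x, ‖S.form (T' x) (T' x)‖ ≤ ‖S.form x x‖ * r ^ 2)
    (h : ∀ x y, S.form (T x) y = S.form x (T' y)) (e f : S.Completion) :
    inner C (S.extend T e) f = inner C e (S.extend T' f) := by
  refine S.denseRange_toCompletion.induction_on₂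
    (p := fun e f => inner C (S.extend T e) f = inner C e (S.extend T' f))
    (isClosed_eq (S.continuous_completion_inner.comp
      (((S.extend T).continuous.comp continuous_fst).prodMk continuous_snd))
      (S.continuous_completion_inner.comp
      (continuous_fst.prodMk ((S.extend T').continuous.comp continuous_snd)))) (fun x y => ?_) e f
  rw [extend_toCompletion hr hT, extend_toCompletion hr hT', inner_toCompletion,
    inner_toCompletion, h]

end SemiInner

/-! ### Pre-correspondences -/

/-- A semi-inner product module over `C` with a left action of the C⋆-algebra `A`. Additivity and
homogeneity in `A` are only required modulo null vectors. -/
structure PreCorrespondence (A C V : Type*) [CStarAlgebra A] [CStarAlgebra C] [PartialOrder C]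
    [AddCommGroup V] [Module ℂ V] [Module C V] extends SemiInner C V where
  act : A → V →ₗ[ℂ] V
  form_act_left : ∀ a x y, form (act a x) y = form x (act (star a) y)
  act_one : ∀ x, act 1 x = x
  act_mul : ∀ a b x, act (a * b) x = act a (act b x)
  form_act_add : ∀ a b x y, form x (act (a + b) y) = form x (act a y) + form x (act b y)
  form_act_smul : ∀ (c : ℂ) a x y, form x (act (c • a) y) = c • form x (act a y)

namespace PreCorrespondence

section Action

variable {A C V : Type*} [CStarAlgebra A] [CStarAlgebra C] [PartialOrder C] [StarOrderedRing C]
  [AddCommGroup V] [Module ℂ V] [Module C V] (P : PreCorrespondence A C V)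

/-- The orthogonal direct sum of two copies of `P`. -/
noncomputable def double : PreCorrespondence A C (V × V) where
  form := LinearMap.mk₂'ₛₗ (starRingEnd ℂ) (RingHom.id ℂ)
    (fun x y => P.form x.1 y.1 + P.form x.2 y.2)
    (fun x x' y => by
      simp only [Prod.fst_add, Prod.snd_add, map_add, LinearMap.add_apply]; abel)
    (fun c x y => by
      simp only [Prod.smul_fst, Prod.smul_snd, LinearMap.map_smulₛₗ, LinearMap.smul_apply,
        smul_add])
    (fun x y y' => by simp only [Prod.fst_add, Prod.snd_add, map_add]; abel)
    (fun c x y => by simp only [Prod.smul_fst, Prod.smul_snd, map_smul, smul_add,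
      RingHom.id_apply])
  form_smul_right c x y := by
    simp only [LinearMap.mk₂'ₛₗ_apply, Prod.smul_fst, Prod.smul_snd, P.form_smul_right, mul_add]
  form_self_nonneg x := add_nonneg (P.form_self_nonneg _) (P.form_self_nonneg _)
  act a := (P.act a).prodMap (P.act a)
  form_act_left a x y := by
    simp only [LinearMap.mk₂'ₛₗ_apply, LinearMap.prodMap_apply, P.form_act_left]
  act_one x := by simp only [LinearMap.prodMap_apply, P.act_one]
  act_mul a b x := by simp only [LinearMap.prodMap_apply, P.act_mul]
  form_act_add a b x y := by
    simp only [LinearMap.mk₂'ₛₗ_apply, LinearMap.prodMap_apply, P.form_act_add]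
    abel
  form_act_smul c a x y := by
    simp only [LinearMap.mk₂'ₛₗ_apply, LinearMap.prodMap_apply, P.form_act_smul, smul_add]

theorem double_form (x y : V × V) :
    P.double.form x y = P.form x.1 y.1 + P.form x.2 y.2 := rfl

theorem double_act (a : A) (x : V × V) : P.double.act a x = (P.act a x.1, P.act a x.2) := rfl

variable [PartialOrder A] [StarOrderedRing A]

/-- The action of `A` is bounded: apply `norm_map_star_mul_self_le` to `a ↦ ⟪x, a · x⟫`. -/
theorem norm_form_act_le (a : A) (x : V) :
    ‖P.form (P.act a x) (P.act a x)‖ ≤ ‖P.form x x‖ * ‖a‖ ^ 2 := by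
  let φ : A →ₗ[ℂ] C :=
    { toFun := fun c => P.form x (P.act c x)
      map_add' := fun c d => P.form_act_add c d x x
      map_smul' := fun z c => P.form_act_smul z c x x }
  have hφ : ∀ r, φ (star r * r) = P.form (P.act r x) (P.act r x) := fun r => by
    rw [P.form_act_left, ← P.act_mul]
    rfl
  have h := norm_map_star_mul_self_le φ (fun r => (hφ r).symm ▸ P.form_self_nonneg _) a
  rw [hφ] at h
  simpa only [φ, LinearMap.coe_mk, AddHom.coe_mk, P.act_one] using h

theorem extend_act (a : A) (x : V) :
    P.extend (P.act a) (P.toCompletion x) = P.toCompletion (P.act a x) :=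
  SemiInner.extend_toCompletion (norm_nonneg a) (P.norm_form_act_le a) x

/-- The representation of `A` on the completion. -/
noncomputable def lact : A →ₐ[ℂ] (P.Completion →L[ℂ] P.Completion) :=
  AlgHom.ofLinearMap
    { toFun := fun a => P.extend (P.act a)
      map_add' := fun a b => SemiInner.clm_ext fun x => by
        rw [add_apply, extend_act, extend_act, extend_act, ← map_add]
        exact P.toCompletion_eq_of_form_eq fun z => by rw [P.form_act_add, map_add]
      map_smul' := fun c a => SemiInner.clm_ext fun x => by
        rw [RingHom.id_apply, smul_apply, extend_act, extend_act, ← map_smul]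
        exact P.toCompletion_eq_of_form_eq fun z => by rw [P.form_act_smul, map_smul] }
    (SemiInner.clm_ext fun x => by
      rw [LinearMap.coe_mk, AddHom.coe_mk, extend_act, act_one]; rfl)
    (fun a b => SemiInner.clm_ext fun x => by
      rw [LinearMap.coe_mk, AddHom.coe_mk, mul_apply_eq_comp, extend_act, extend_act,
        extend_act, act_mul])

theorem lact_toCompletion (a : A) (x : V) :
    P.lact a (P.toCompletion x) = P.toCompletion (P.act a x) :=
  P.extend_act a x

theorem inner_lact (a : A) (e f : P.Completion) :
    inner C (P.lact (star a) e) f = inner C e (P.lact a f) :=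
  SemiInner.inner_extend (norm_nonneg a)
    (fun x => (P.norm_form_act_le _ x).trans_eq (by rw [norm_star]))
    (P.norm_form_act_le a)
    (fun x y => by rw [form_act_left, star_star]) e f

end Action

section Correspondence

variable {A B V : Type*} [CStarAlgebra A] [PartialOrder A] [StarOrderedRing A] [CStarAlgebra B]
  [PartialOrder B] [StarOrderedRing B] [AddCommGroup V] [Module ℂ V] [Module Bᵐᵒᵖ V]

/-- The completion of a pre-correspondence over `Bᵐᵒᵖ`, as an `(A, B)`-correspondence. -/
noncomputable def toCorrespondence (P : PreCorrespondence A Bᵐᵒᵖ V) : Correspondence A B where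
  carrier := P.Completion
  lact := P.lact
  inner_lact := P.inner_lact

end Correspondence

end PreCorrespondence

/-! ### The Kolmogorov construction -/

theorem IsCompletelyPositive.sum_nonneg {Y A B ι : Type*} [CStarAlgebra A] [CStarAlgebra B]
    [PartialOrder B] [Fintype ι] {K : Kernel Y A B} (hK : IsCompletelyPositive K) (y : ι → Y)
    (a : ι → A) (b : ι → B) :
    0 ≤ ∑ i, ∑ j, star (b i) * K (y i) (y j) (star (a i) * a j) * b j := by
  let e := (Fintype.equivFin ι).symm
  refine (hK _ (y ∘ e) (a ∘ e) (b ∘ e)).trans_eq ?_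
  refine Fintype.sum_equiv e _ _ fun i => ?_
  exact Fintype.sum_equiv e _ _ fun j => rfl

section Gram

variable {Y : Type*} {A : Type*} {B : Type*} [CStarAlgebra A] [CStarAlgebra B]

/-- The sesquilinear form of a kernel on formal sums `∑ (y, a) b`: it sends the pair of
`(y, a) b` and `(y', a') b'` to `b* K(y, y')[a* a'] b'`. -/
noncomputable def gramSum (K : Kernel Y A B) (f g : Y × A →₀ B) : B :=
  f.sum fun s u => g.sum fun t v => star u * K s.1 t.1 (star s.2 * t.2) * v

variable (K : Kernel Y A B)

theorem gramSum_add_right (f g g' : Y × A →₀ B) :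
    gramSum K f (g + g') = gramSum K f g + gramSum K f g' := by
  rw [gramSum, gramSum, gramSum, ← Finsupp.sum_add]
  refine Finsupp.sum_congr fun s _ => ?_
  exact Finsupp.sum_add_index' (fun t => mul_zero _) fun t v v' => mul_add _ _ _

theorem gramSum_add_left (f f' g : Y × A →₀ B) :
    gramSum K (f + f') g = gramSum K f g + gramSum K f' g := by
  refine Finsupp.sum_add_index' (fun s => ?_) fun s u u' => ?_
  · simp [Finsupp.sum]
  · rw [← Finsupp.sum_add]
    exact Finsupp.sum_congr fun t _ => by rw [star_add, add_mul, add_mul]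

theorem gramSum_smul_right (c : ℂ) (f g : Y × A →₀ B) :
    gramSum K f (c • g) = c • gramSum K f g := by
  rw [gramSum, gramSum, Finsupp.smul_sum]
  refine Finsupp.sum_congr fun s _ => ?_
  rw [Finsupp.sum_smul_index' (fun t => mul_zero _), Finsupp.smul_sum]
  exact Finsupp.sum_congr fun t _ => mul_smul_comm _ _ _

theorem gramSum_smul_left (c : ℂ) (f g : Y × A →₀ B) :
    gramSum K (c • f) g = starRingEnd ℂ c • gramSum K f g := by
  rw [gramSum, gramSum, Finsupp.sum_smul_index' (fun s => by simp [Finsupp.sum]),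
    Finsupp.smul_sum]
  refine Finsupp.sum_congr fun s _ => ?_
  rw [Finsupp.smul_sum]
  exact Finsupp.sum_congr fun t _ => by
    rw [star_smul, smul_mul_assoc, smul_mul_assoc, starRingEnd_apply]

theorem gramSum_op_smul_right (b : B) (f g : Y × A →₀ B) :
    gramSum K f (MulOpposite.op b • g) = gramSum K f g * b := by
  rw [gramSum, gramSum, Finsupp.sum_mul]
  refine Finsupp.sum_congr fun s _ => ?_
  rw [Finsupp.sum_smul_index' (fun t => mul_zero _), Finsupp.sum_mul]
  exact Finsupp.sum_congr fun t _ => by rw [op_smul_eq_mul, ← mul_assoc]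

/-- Left multiplication by `a` on formal sums, `(y, a') b ↦ (y, a a') b`. -/
noncomputable def gramAct (a : A) : (Y × A →₀ B) →ₗ[ℂ] (Y × A →₀ B) :=
  Finsupp.lmapDomain B ℂ fun s => (s.1, a * s.2)

theorem gramSum_act_right (a : A) (f g : Y × A →₀ B) :
    gramSum K f (gramAct a g) =
      f.sum fun s u => g.sum fun t v => star u * K s.1 t.1 (star s.2 * (a * t.2)) * v := by
  refine Finsupp.sum_congr fun s _ => ?_
  exact Finsupp.sum_mapDomain_index (fun t => mul_zero _) fun t v v' => mul_add _ _ _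

theorem gramSum_add_act (a b : A) (f g : Y × A →₀ B) :
    gramSum K f (gramAct (a + b) g) = gramSum K f (gramAct a g) + gramSum K f (gramAct b g) := by
  rw [gramSum_act_right, gramSum_act_right, gramSum_act_right, ← Finsupp.sum_add]
  refine Finsupp.sum_congr fun s _ => ?_
  rw [← Finsupp.sum_add]
  exact Finsupp.sum_congr fun t _ => by rw [add_mul, mul_add, map_add, mul_add, add_mul]

theorem gramSum_smul_act (c : ℂ) (a : A) (f g : Y × A →₀ B) :
    gramSum K f (gramAct (c • a) g) = c • gramSum K f (gramAct a g) := by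
  rw [gramSum_act_right, gramSum_act_right, Finsupp.smul_sum]
  refine Finsupp.sum_congr fun s _ => ?_
  rw [Finsupp.smul_sum]
  exact Finsupp.sum_congr fun t _ => by
    rw [smul_mul_assoc, mul_smul_comm, map_smul, mul_smul_comm, smul_mul_assoc]

theorem gramSum_act_left (a : A) (f g : Y × A →₀ B) :
    gramSum K (gramAct a f) g = gramSum K f (gramAct (star a) g) := by
  rw [gramSum_act_right]
  refine (Finsupp.sum_mapDomain_index (fun s => ?_) fun s u u' => ?_).trans ?_
  · simp [Finsupp.sum]
  · rw [← Finsupp.sum_add]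
    exact Finsupp.sum_congr fun t _ => by rw [star_add, add_mul, add_mul]
  · simp only [star_mul, mul_assoc]

theorem gramSum_single (y y' : Y) (a a' : A) (b b' : B) :
    gramSum K (Finsupp.single (y, a) b) (Finsupp.single (y', a') b') =
      star b * K y y' (star a * a') * b' := by
  rw [gramSum, Finsupp.sum_single_index, Finsupp.sum_single_index]
  · rw [mul_zero]
  · simp [Finsupp.sum]

variable [PartialOrder B] {K}

theorem IsCompletelyPositive.gramSum_self_nonneg (hK : IsCompletelyPositive K)
    (f : Y × A →₀ B) : 0 ≤ gramSum K f f := by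
  refine (hK.sum_nonneg (ι := f.support) (fun s => s.1.1) (fun s => s.1.2)
    (fun s => f s)).trans_eq ?_
  rw [gramSum, Finsupp.sum, ← Finset.sum_coe_sort f.support]
  refine Finset.sum_congr rfl fun s _ => ?_
  rw [Finsupp.sum, ← Finset.sum_coe_sort f.support]

/-- The pre-correspondence of formal sums `∑ (y, a) b` defined by a completely positive kernel. -/
noncomputable def IsCompletelyPositive.gram (hK : IsCompletelyPositive K) :
    PreCorrespondence A Bᵐᵒᵖ (Y × A →₀ B) where
  form := LinearMap.mk₂'ₛₗ (starRingEnd ℂ) (RingHom.id ℂ)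
    (fun f g => MulOpposite.op (gramSum K f g))
    (fun f f' g => by rw [gramSum_add_left, MulOpposite.op_add])
    (fun c f g => by rw [gramSum_smul_left, MulOpposite.op_smul])
    (fun f g g' => by rw [gramSum_add_right, MulOpposite.op_add])
    (fun c f g => by rw [gramSum_smul_right, MulOpposite.op_smul, RingHom.id_apply])
  form_smul_right c f g := by
    induction c using MulOpposite.rec' with
    | h b => exact congrArg MulOpposite.op (gramSum_op_smul_right K b f g)
  form_self_nonneg f := hK.gramSum_self_nonneg f
  act := gramAct
  form_act_left a f g := congrArg MulOpposite.op (gramSum_act_left K a f g)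
  act_one f := by
    refine (Finsupp.mapDomain_congr fun s _ => ?_).trans Finsupp.mapDomain_id
    simp
  act_mul a b f := by
    refine (Finsupp.mapDomain_congr fun s _ => ?_).trans Finsupp.mapDomain_comp
    simp [mul_assoc]
  form_act_add a b f g := congrArg MulOpposite.op (gramSum_add_act K a b f g)
  form_act_smul c a f g := congrArg MulOpposite.op (gramSum_smul_act K c a f g)

theorem IsCompletelyPositive.gram_form (hK : IsCompletelyPositive K) (f g : Y × A →₀ B) :
    hK.gram.form f g = MulOpposite.op (gramSum K f g) := rfl

theorem IsCompletelyPositive.gram_act (hK : IsCompletelyPositive K) (a : A) :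
    hK.gram.act a = gramAct a := rfl

end Gram

section Shift

/-- The shift `(u, v) ↦ (0, u)` on two copies of a module. -/
def shift (V : Type*) [AddCommGroup V] [Module ℂ V] : V × V →ₗ[ℂ] V × V :=
  LinearMap.inr ℂ V V ∘ₗ LinearMap.fst ℂ V V

/-- The backward shift `(u, v) ↦ (v, 0)` on two copies of a module. -/
def backShift (V : Type*) [AddCommGroup V] [Module ℂ V] : V × V →ₗ[ℂ] V × V :=
  LinearMap.inl ℂ V V ∘ₗ LinearMap.snd ℂ V V

namespace PreCorrespondence

variable {A C V : Type*} [CStarAlgebra A] [CStarAlgebra C] [PartialOrder C] [StarOrderedRing C]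
  [AddCommGroup V]
  [Module ℂ V] [Module C V] (P : PreCorrespondence A C V)

theorem double_form_shift_le (x : V × V) :
    ‖P.double.form (shift V x) (shift V x)‖ ≤ ‖P.double.form x x‖ * 1 ^ 2 := by
  have h : P.double.form (shift V x) (shift V x) = P.form x.1 x.1 := by
    rw [double_form]; simp [shift]
  rw [h, one_pow, mul_one, double_form]
  exact CStarAlgebra.norm_le_norm_of_nonneg_of_le (P.form_self_nonneg _)
    (le_add_of_nonneg_right (P.form_self_nonneg _))

theorem double_form_backShift_le (x : V × V) :
    ‖P.double.form (backShift V x) (backShift V x)‖ ≤ ‖P.double.form x x‖ * 1 ^ 2 := by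
  have h : P.double.form (backShift V x) (backShift V x) = P.form x.2 x.2 := by
    rw [double_form]; simp [backShift]
  rw [h, one_pow, mul_one, double_form]
  exact CStarAlgebra.norm_le_norm_of_nonneg_of_le (P.form_self_nonneg _)
    (le_add_of_nonneg_left (P.form_self_nonneg _))

end PreCorrespondence

end Shift

section Kolmogorov

variable {X : Type uX} {A : Type uA} {B : Type uB} [CStarAlgebra A] [PartialOrder A]
  [StarOrderedRing A] [CStarAlgebra B] [PartialOrder B] [StarOrderedRing B]

/-- An off-diagonal corner of a completely positive kernel has a Kolmogorov decomposition. If `ι₁`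
and `ι₂` are the two halves of the Kolmogorov map of the large kernel on `E`, then
`ι(x) = (ι₁(x), ι₂(x))` and the shift `(u, v) ↦ (0, u)` on `E ⊕ E` decompose the corner. -/
theorem IsCompletelyPositive.hasKolmogorovDecomposition_corner {K : Kernel (X × Fin 2) A B}
    (hK : IsCompletelyPositive K) :
    HasKolmogorovDecomposition fun x y : X => K (x, 0) (y, 1) := by
  let P := hK.gram
  let D := P.double
  let ξ (x : X) (p : Fin 2) : (X × Fin 2) × A →₀ B := Finsupp.single ((x, p), 1) 1
  have hJ : ∀ v, D.extend (shift _) (D.toCompletion v) = D.toCompletion (shift _ v) :=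
    SemiInner.extend_toCompletion zero_le_one P.double_form_shift_le
  refine ⟨D.toCorrespondence, D.extend (shift _), fun x => D.toCompletion (ξ x 0, ξ x 1),
    ⟨D.extend (backShift _), fun e f => ?_⟩,
    SemiInner.norm_extend_le zero_le_one P.double_form_shift_le, fun a e => ?_, fun x y a => ?_⟩
  · refine congrArg MulOpposite.unop (SemiInner.inner_extend (S := D.toSemiInner) zero_le_one
      P.double_form_backShift_le P.double_form_shift_le (fun u v => ?_) f e).symm
    rw [P.double_form, P.double_form]
    simp [shift, backShift]
  · refine DFunLike.congr_fun (SemiInner.clm_ext (S := D.toSemiInner)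
      (T := (D.extend (shift _)).comp (D.lact a)) (T' := (D.lact a).comp (D.extend (shift _)))
      fun v => ?_) e
    rw [ContinuousLinearMap.comp_apply, ContinuousLinearMap.comp_apply, hJ, D.lact_toCompletion,
      D.lact_toCompletion, hJ, P.double_act, P.double_act]
    simp [shift]
  · have h : D.form (shift _ (ξ x 0, ξ x 1)) (D.act a (ξ y 0, ξ y 1)) =
        MulOpposite.op (K (x, 0) (y, 1) a) := by
      rw [P.double_act, P.double_form]
      simp only [shift, LinearMap.comp_apply, LinearMap.fst_apply, LinearMap.inr_apply, map_zero,
        LinearMap.zero_apply, zero_add]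
      rw [hK.gram_form, hK.gram_act, gramAct, Finsupp.lmapDomain_apply,
        Finsupp.mapDomain_single, gramSum_single]
      simp
    change K (x, 0) (y, 1) a = MulOpposite.unop (inner Bᵐᵒᵖ
      (D.extend (shift _) (D.toCompletion (ξ x 0, ξ x 1)))
      (D.lact a (D.toCompletion (ξ y 0, ξ y 1))))
    rw [hJ, D.lact_toCompletion, SemiInner.inner_toCompletion, h, MulOpposite.unop_op]

end Kolmogorov

/-! ### Positivity of matrices over a C⋆-algebra -/

section Generic

variable {D : Type*} [CStarAlgebra D] [PartialOrder D] [StarOrderedRing D]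

/-- The facts of this section are stated for an abstract C⋆-algebra in order to be applied to
`CStarMatrix`, for which the functional calculus instances are not found directly. -/
theorem exists_eq_star_mul_self {x : D} (hx : 0 ≤ x) : ∃ r, x = star r * r :=
  CStarAlgebra.nonneg_iff_eq_star_mul_self.1 hx

/-- With `N = x⁻` the negative part of `x` and `N = S* S`, one has
`N x N = -N³ = -(S N)* (S N)`; and `S N = 0` forces `N² = 0`, hence `x ≥ 0`. -/
theorem exists_conj_eq_neg {x : D} (hx : IsSelfAdjoint x) :
    ∃ N R : D, star N * x * N = -(star R * R) ∧ (R = 0 → 0 ≤ x) := by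
  obtain ⟨S, hS⟩ := exists_eq_star_mul_self (CFC.negPart_nonneg x)
  have hN : star x⁻ = x⁻ := (IsSelfAdjoint.of_nonneg (CFC.negPart_nonneg x)).star_eq
  refine ⟨x⁻, S * x⁻, ?_, fun h => ?_⟩
  · have h₁ : x⁻ * x = -(x⁻ * x⁻) := by
      nth_rw 2 [← CFC.posPart_sub_negPart x hx]
      rw [mul_sub, CFC.negPart_mul_posPart, zero_sub]
    have h₂ : star (S * x⁻) * (S * x⁻) = x⁻ * x⁻ * x⁻ := by
      rw [star_mul, hN, mul_assoc, ← mul_assoc (star S), ← hS, mul_assoc]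
    rw [hN, h₁, h₂, neg_mul]
  · have h₁ : star x⁻ * x⁻ = 0 := by
      rw [hN]
      nth_rw 1 [hS]
      rw [mul_assoc, h, mul_zero]
    rw [← CFC.posPart_sub_negPart x hx, (CStarRing.star_mul_self_eq_zero_iff _).1 h₁, sub_zero]
    exact CFC.posPart_nonneg x

theorem norm_le_of_le_algebraMap {x : D} {r : ℝ} (hr : 0 ≤ r) (hx : 0 ≤ x)
    (h : x ≤ algebraMap ℝ D r) : ‖x‖ ≤ r :=
  (CStarAlgebra.norm_le_iff_le_algebraMap x hr hx).2 h

/-- A positive linear map `Φ` satisfies `‖Φ x‖ ≤ 4 ‖Φ 1‖ ‖x‖`: write `x` as a combination of four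
positive elements. -/
theorem norm_map_le_of_nonneg {D' : Type*} [CStarAlgebra D'] [PartialOrder D']
    [StarOrderedRing D'] (Φ : D →ₗ[ℂ] D') (hΦ : ∀ x, 0 ≤ x → 0 ≤ Φ x) (x : D) :
    ‖Φ x‖ ≤ 4 * ‖Φ 1‖ * ‖x‖ := by
  obtain ⟨y, hy, hyx, hx⟩ := CStarAlgebra.exists_sum_four_nonneg x
  conv_lhs => rw [hx]
  rw [map_sum]
  refine (norm_sum_le _ _).trans ?_
  refine (Finset.sum_le_sum (g := fun _ => ‖Φ 1‖ * ‖x‖) fun i _ => ?_).trans_eq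
    (by simp [mul_assoc])
  rw [map_smul, norm_smul, norm_pow, Complex.norm_I, one_pow, one_mul]
  refine ((PositiveLinearMap.mk₀ Φ hΦ).norm_apply_le_of_nonneg _ (hy i)).trans ?_
  exact mul_le_mul_of_nonneg_left (hyx i) (norm_nonneg _)

end Generic

section Positivity

theorem matrix_sum_apply {B κ m n : Type*} [AddCommMonoid B] [Fintype κ]
    (F : κ → CStarMatrix m n B) (i : m) (j : n) : (∑ k, F k) i j = ∑ k, F k i j :=
  Matrix.sum_apply i j Finset.univ F

variable {B ι : Type*} [CStarAlgebra B] [Fintype ι]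

/-- The value `c* M c = ∑ i j, cᵢ* Mᵢⱼ cⱼ` of the matrix `M` at the column `c`. -/
def quad (c : ι → B) : CStarMatrix ι ι B →+ B where
  toFun M := ∑ i, ∑ j, star (c i) * M i j * c j
  map_zero' := by simp
  map_add' M N := by simp only [CStarMatrix.add_apply, mul_add, add_mul, Finset.sum_add_distrib]

theorem quad_apply (c : ι → B) (M : CStarMatrix ι ι B) :
    quad c M = ∑ i, ∑ j, star (c i) * M i j * c j := rfl

open scoped Matrix in
theorem quad_star_mul_mul (c : ι → B) (b S b' : CStarMatrix ι ι B) :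
    quad c (star b * S * b') =
      ∑ p, ∑ q, star (∑ r, b p r * c r) * S p q * ∑ s, b' q s * c s := by
  have h₁ : ∀ (d e : ι → B) (T : Matrix ι ι B),
      star d ⬝ᵥ (T *ᵥ e) = ∑ p, ∑ q, star (d p) * T p q * e q := fun d e T => by
    simp only [dotProduct, Matrix.mulVec, Finset.mul_sum, Pi.star_apply, mul_assoc]
  have h₂ : ∀ b S b' : Matrix ι ι B,
      star c ⬝ᵥ ((bᴴ * S * b') *ᵥ c) = star (b *ᵥ c) ⬝ᵥ (S *ᵥ (b' *ᵥ c)) := fun b S b' => by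
    rw [← Matrix.mulVec_mulVec, ← Matrix.mulVec_mulVec, Matrix.dotProduct_mulVec,
      Matrix.star_mulVec]
  simp only [h₁] at h₂
  exact h₂ b S b'

variable [PartialOrder B] [StarOrderedRing B] [DecidableEq ι]

/-- A matrix `M` over a C⋆-algebra is positive as soon as `c* M c ≥ 0` for all columns `c`.
Testing on the columns of `M⁻` shows that the diagonal of `M⁻ M M⁻ = -(M⁻)³` is both `≥ 0`
and `≤ 0`, which forces `M⁻ = 0`. -/
theorem nonneg_of_quad_nonneg {M : CStarMatrix ι ι B} (h : ∀ c, 0 ≤ quad c M) : 0 ≤ M := by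
  have hM : IsSelfAdjoint M := by
    let Q : (ι → B) →ₗ⋆[ℂ] (ι → B) →ₗ[ℂ] B :=
      LinearMap.mk₂'ₛₗ (starRingEnd ℂ) (RingHom.id ℂ)
        (fun c d => ∑ i, ∑ j, star (c i) * M i j * d j)
        (fun c c' d => by
          simp only [Pi.add_apply, star_add, add_mul, Finset.sum_add_distrib])
        (fun z c d => by
          simp only [Pi.smul_apply, star_smul, smul_mul_assoc, Finset.smul_sum, starRingEnd_apply])
        (fun c d d' => by
          simp only [Pi.add_apply, mul_add, Finset.sum_add_distrib])
        (fun z c d => by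
          simp only [Pi.smul_apply, mul_smul_comm, Finset.smul_sum, RingHom.id_apply])
    have hQ : ∀ i j, Q (Pi.single i 1) (Pi.single j 1) = M i j := fun i j => by
      simp only [Q, LinearMap.mk₂'ₛₗ_apply]
      rw [Finset.sum_eq_single i, Finset.sum_eq_single j] <;> simp +contextual
    ext i j
    rw [CStarMatrix.star_apply, ← hQ, ← hQ]
    exact star_sesquilinear_apply Q (fun c => (IsSelfAdjoint.of_nonneg (h c)).star_eq) _ _
  obtain ⟨N, R, h₁, h₂⟩ := exists_conj_eq_neg hM
  refine h₂ ?_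
  ext k r
  have h₃ : quad (Pi.single r 1) (star N * M * N) = -∑ k, star (R k r) * R k r := by
    rw [h₁, map_neg, quad_apply, Finset.sum_eq_single r, Finset.sum_eq_single r] <;>
      simp +contextual [CStarMatrix.mul_apply, CStarMatrix.star_apply]
  have h₄ : 0 ≤ quad (Pi.single r 1) (star N * M * N) := by
    rw [quad_star_mul_mul]
    exact h fun p => ∑ s, N p s * (Pi.single r 1 : ι → B) s
  rw [h₃, neg_nonneg] at h₄
  have h₅ := (Finset.sum_eq_zero_iff_of_nonneg fun k _ => star_mul_self_nonneg _).1
    (le_antisymm h₄ (Finset.sum_nonneg fun k _ => star_mul_self_nonneg _)) k (Finset.mem_univ k)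
  exact (CStarRing.star_mul_self_eq_zero_iff _).1 h₅

theorem quad_nonneg {M : CStarMatrix ι ι B} (hM : 0 ≤ M)
    (c : ι → B) : 0 ≤ quad c M := by
  obtain ⟨R, rfl⟩ := exists_eq_star_mul_self hM
  rw [← mul_one (star R), quad_star_mul_mul]
  refine Finset.sum_nonneg fun p _ => ?_
  rw [Finset.sum_eq_single p (fun q _ hq => by simp [CStarMatrix.one_apply_ne hq.symm]) (by simp),
    CStarMatrix.one_apply_eq, mul_one]
  exact star_mul_self_nonneg _

end Positivity

/-! ### Schur products and complete boundedness -/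

section Schur

variable {Y Z A B : Type*} [CStarAlgebra A] [PartialOrder A] [StarOrderedRing A]
  [CStarAlgebra B] [PartialOrder B] [StarOrderedRing B]

theorem sum_reorder {M ι κ τ : Type*} [AddCommMonoid M] [Fintype ι] [Fintype κ] [Fintype τ]
    (F : ι → κ → ι → κ → τ → M) :
    ∑ i, ∑ j, ∑ p, ∑ q, ∑ t, F i p j q t =
      ∑ t, ∑ x : ι × κ, ∑ y : ι × κ, F x.1 x.2 y.1 y.2 t := by
  simp only [Fintype.sum_prod_type]
  rw [Finset.sum_comm (s := (Finset.univ : Finset τ))]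
  refine Finset.sum_congr rfl fun i _ => ?_
  rw [Finset.sum_comm, Finset.sum_comm (s := (Finset.univ : Finset τ))]
  refine Finset.sum_congr rfl fun p _ => ?_
  rw [Finset.sum_comm (s := (Finset.univ : Finset τ))]
  exact Finset.sum_congr rfl fun j _ => Finset.sum_comm

/-- The Schur product kernel attached to `n`-tuples `y z` of points of `Y`: a completely positive
kernel on `Y` gives a completely positive kernel with values in `L(Mₙ(A), Mₙ(B))`. -/
theorem IsCompletelyPositive.schur {K : Kernel Y A B} (hK : IsCompletelyPositive K) {n : ℕ}
    (y : Z → Fin n → Y) :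
    IsCompletelyPositive (fun z z' => schurMap (Matrix.of fun p q => K (y z p) (y z' q)) :
      Kernel Z (CStarMatrix (Fin n) (Fin n) A) (CStarMatrix (Fin n) (Fin n) B)) := by
  intro m z a b
  refine nonneg_of_quad_nonneg fun c => ?_
  simp only [map_sum, quad_star_mul_mul]
  let d (i : Fin m) (p : Fin n) : B := ∑ r, b i p r * c r
  have h : ∀ i j p q, schurMap (Matrix.of fun p q => K (y (z i) p) (y (z j) q))
      (star (a i) * a j) p q =
        ∑ t, K (y (z i) p) (y (z j) q) (star (a i t p) * a j t q) := fun i j p q => by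
    rw [← map_sum]
    rfl
  simp only [h]
  change 0 ≤ ∑ i, ∑ j, ∑ p, ∑ q, star (d i p) *
    (∑ t, K (y (z i) p) (y (z j) q) (star (a i t p) * a j t q)) * d j q
  simp only [Finset.sum_mul, Finset.mul_sum]
  rw [sum_reorder fun i p j q t =>
    star (d i p) * K (y (z i) p) (y (z j) q) (star (a i t p) * a j t q) * d j q]
  exact Finset.sum_nonneg fun t _ => hK.sum_nonneg (fun s : Fin m × Fin n => y (z s.1) s.2)
    (fun s => a s.1 t s.2) (fun s => d s.1 s.2)

/-- The amplifications of a completely positive map are positive, so that the norm of the `m`-th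
one is controlled by its value at `1`, which is the diagonal matrix with entries `φ 1`. -/
theorem IsCompletelyPositive.isCompletelyBoundedMap {φ : A →L[ℂ] B}
    (hφ : IsCompletelyPositive (fun _ _ => φ : Kernel Unit A B)) : IsCompletelyBoundedMap φ := by
  refine ⟨4 * ‖φ 1‖, fun m M => ?_⟩
  let Φ : CStarMatrix (Fin m) (Fin m) A →ₗ[ℂ] CStarMatrix (Fin m) (Fin m) B :=
    CStarMatrix.mapₗ φ.toLinearMap
  have hΦ : ∀ N, 0 ≤ N → 0 ≤ Φ N := fun N hN => by
    obtain ⟨R, rfl⟩ := exists_eq_star_mul_self hN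
    refine nonneg_of_quad_nonneg fun c => ?_
    have h : quad c (Φ (star R * R)) =
        ∑ t, ∑ i, ∑ j, star (c i) * φ (star (R t i) * R t j) * c j := by
      have h' : ∀ i j, Φ (star R * R) i j = ∑ t, φ (star (R t i) * R t j) := fun i j => by
        rw [← map_sum]
        rfl
      simp only [quad_apply, h', Finset.sum_mul, Finset.mul_sum]
      exact Finset.sum_comm_cycle
    rw [h]
    exact Finset.sum_nonneg fun t _ => hφ m (fun _ => ()) (fun i => R t i) c
  have hφ1 : 0 ≤ φ 1 := by
    simpa using hφ 1 (fun _ => ()) (fun _ => 1) (fun _ => 1)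
  have h1 : ‖Φ 1‖ ≤ ‖φ 1‖ := by
    refine norm_le_of_le_algebraMap (norm_nonneg _) (hΦ 1 zero_le_one) (sub_nonneg.1 ?_)
    refine nonneg_of_quad_nonneg fun c => ?_
    have h : quad c (algebraMap ℝ _ ‖φ 1‖ - Φ 1) =
        ∑ i, star (c i) * (algebraMap ℝ B ‖φ 1‖ - φ 1) * c i := by
      rw [quad_apply]
      refine Finset.sum_congr rfl fun i _ => ?_
      rw [Finset.sum_eq_single i]
      · simp [Φ, Algebra.algebraMap_eq_smul_one]
      · intro j _ hj
        simp [Φ, Algebra.algebraMap_eq_smul_one, CStarMatrix.one_apply_ne hj.symm]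
      · simp
    refine le_of_le_of_eq ?_ h.symm
    exact Finset.sum_nonneg fun i _ => star_left_conjugate_nonneg
      (sub_nonneg.2 (IsSelfAdjoint.of_nonneg hφ1).le_algebraMap_norm_self) _
  refine (norm_map_le_of_nonneg Φ hΦ M).trans ?_
  exact mul_le_mul_of_nonneg_right (mul_le_mul_of_nonneg_left h1 zero_le_four) (norm_nonneg _)

theorem IsCompletelyBoundedMap.sum_smul {ι : Type*} [Fintype ι] {φ : ι → A →L[ℂ] B}
    (hφ : ∀ i, IsCompletelyBoundedMap (φ i)) (c : ι → ℂ) :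
    IsCompletelyBoundedMap (∑ i, c i • φ i) := by
  choose C hC using hφ
  refine ⟨∑ i, ‖c i‖ * C i, fun m M => ?_⟩
  have h : M.map (∑ i, c i • φ i : A →L[ℂ] B) = ∑ i, c i • M.map (φ i) := by
    ext p q
    rw [CStarMatrix.map_apply, sum_apply]
    exact (matrix_sum_apply (fun i => c i • M.map (φ i)) p q).symm
  rw [h, Finset.sum_mul]
  refine (norm_sum_le _ _).trans (Finset.sum_le_sum fun i _ => ?_)
  rw [norm_smul, mul_assoc]
  exact mul_le_mul_of_nonneg_left (hC i m M) (norm_nonneg _)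

/-- A linear combination of completely positive kernels is completely bounded. -/
theorem isCompletelyBounded_sum_smul {ι : Type*} [Fintype ι] {L : ι → Kernel Y A B}
    (hL : ∀ i, IsCompletelyPositive (L i)) (c : ι → ℂ) :
    IsCompletelyBounded (∑ i, c i • L i) := by
  intro n x _
  have h : schurMap (Matrix.of fun p q => (∑ i, c i • L i) (x p) (x q)) =
      ∑ i, c i • schurMap (Matrix.of fun p q => L i (x p) (x q)) := by
    ext M p q
    rw [sum_apply, matrix_sum_apply]
    change (∑ i, c i • L i) (x p) (x q) (M p q) = _
    rw [Finset.sum_apply, Finset.sum_apply, sum_apply]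
    rfl
  rw [h]
  exact IsCompletelyBoundedMap.sum_smul
    (fun i => ((hL i).schur (Z := Unit) fun _ => x).isCompletelyBoundedMap) c

end Schur

/-! ### Kernels defined by vectors of a correspondence -/

section VectorKernel

variable {A : Type uA} {B : Type uB} [CStarAlgebra A] [CStarAlgebra B] [PartialOrder B]

namespace Correspondence

variable (E : Correspondence.{uA, uB, w} A B)

theorem ip_add_left (e e' f : E.carrier) : E.ip (e + e') f = E.ip e f + E.ip e' f := by
  simp [ip]

theorem ip_add_right (e f f' : E.carrier) : E.ip e (f + f') = E.ip e f + E.ip e f' := by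
  simp [ip]

theorem ip_complex_smul_left (c : ℂ) (e f : E.carrier) : E.ip (c • e) f = c • E.ip e f := by
  simp [ip]

theorem ip_complex_smul_right (c : ℂ) (e f : E.carrier) : E.ip e (c • f) = star c • E.ip e f := by
  simp [ip]

theorem ip_sum_sum {ι : Type*} [Fintype ι] (e f : ι → E.carrier) :
    E.ip (∑ j, e j) (∑ i, f i) = ∑ i, ∑ j, E.ip (e j) (f i) := by
  simp only [ip, CStarModule.inner_sum_left, CStarModule.inner_sum_right, Finset.unop_sum]
  exact Finset.sum_comm

theorem ip_self_nonneg (e : E.carrier) : 0 ≤ E.ip e e :=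
  MulOpposite.unop_nonneg.2 CStarModule.inner_self_nonneg

theorem star_ip (e f : E.carrier) : star (E.ip e f) = E.ip f e := by
  rw [ip, ip, ← MulOpposite.unop_star, CStarModule.star_inner]

theorem ip_lact_left (a : A) (e f : E.carrier) :
    E.ip (E.lact a e) f = E.ip e (E.lact (star a) f) :=
  congrArg MulOpposite.unop (E.inner_lact a f e).symm

variable [StarOrderedRing B]

theorem norm_ip_le (e f : E.carrier) : ‖E.ip e f‖ ≤ ‖e‖ * ‖f‖ := by
  rw [ip, MulOpposite.norm_unop, mul_comm]
  exact CStarModule.norm_inner_le E.carrier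

variable [PartialOrder A] [StarOrderedRing A]

/-- The action of `A` is contractive: apply `norm_map_star_mul_self_le` to `a ↦ ⟨a · e, e⟩`. -/
theorem norm_lact_le (a : A) (e : E.carrier) : ‖E.lact a e‖ ≤ ‖a‖ * ‖e‖ := by
  have hsq : ∀ f : E.carrier, ‖f‖ ^ 2 = ‖E.ip f f‖ := fun f => by
    rw [ip, MulOpposite.norm_unop, CStarModule.norm_sq_eq Bᵐᵒᵖ]
  let φ : A →ₗ[ℂ] B :=
    { toFun := fun c => E.ip (E.lact c e) e
      map_add' := fun c d => by rw [map_add, add_apply, ip_add_left]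
      map_smul' := fun z c => by
        rw [map_smul, smul_apply, ip_complex_smul_left, RingHom.id_apply] }
  have hφ : ∀ r, φ (star r * r) = E.ip (E.lact r e) (E.lact r e) := fun r => by
    change E.ip (E.lact (star r * r) e) e = _
    rw [map_mul, mul_apply_eq_comp, ip_lact_left, star_star]
  have h := norm_map_star_mul_self_le φ (fun r => (hφ r).symm ▸ E.ip_self_nonneg _) a
  have h1 : φ 1 = E.ip e e := by
    change E.ip (E.lact 1 e) e = _
    rw [map_one, one_apply_eq_self]
  rw [hφ, h1, ← hsq, ← hsq, ← mul_pow, mul_comm] at h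
  exact (pow_le_pow_iff_left₀ (norm_nonneg _) (by positivity) two_ne_zero).1 h

/-- The kernel `(x, y) ↦ (a ↦ ⟨a · w(y), v(x)⟩)` of two families of vectors. -/
noncomputable def vectorKernel {Z : Type*} (v w : Z → E.carrier) : Kernel Z A B := fun x y =>
  LinearMap.mkContinuous
    { toFun := fun a => E.ip (E.lact a (w y)) (v x)
      map_add' := fun c d => by rw [map_add, add_apply, ip_add_left]
      map_smul' := fun z c => by
        rw [map_smul, smul_apply, ip_complex_smul_left, RingHom.id_apply] }
    (‖w y‖ * ‖v x‖) fun a => by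
      refine (E.norm_ip_le _ _).trans ?_
      rw [mul_comm, mul_comm (‖w y‖), mul_assoc, mul_comm (‖w y‖)]
      exact mul_le_mul_of_nonneg_left (E.norm_lact_le a _) (norm_nonneg _)

variable {Z : Type*}

theorem vectorKernel_apply (v w : Z → E.carrier) (x y : Z) (a : A) :
    E.vectorKernel v w x y a = E.ip (E.lact a (w y)) (v x) := rfl

theorem adjoint_vectorKernel (v w : Z → E.carrier) :
    adjoint (E.vectorKernel v w) = E.vectorKernel w v := by
  ext x y a
  rw [adjoint_apply, vectorKernel_apply, vectorKernel_apply, star_ip, ip_lact_left]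

theorem isCompletelyPositive_vectorKernel (v : Z → E.carrier) :
    IsCompletelyPositive (E.vectorKernel v v) := by
  intro n x a b
  let e (i : Fin n) : E.carrier := MulOpposite.op (b i) • E.lact (a i) (v (x i))
  refine (E.ip_self_nonneg (∑ i, e i)).trans_eq ?_
  rw [ip_sum_sum]
  refine Finset.sum_congr rfl fun i _ => Finset.sum_congr rfl fun j _ => ?_
  rw [vectorKernel_apply, map_mul, mul_apply_eq_comp, E.ip_lact_left (star (a i)), star_star,
    ip_smul_left, ip_smul_right]

/-- Polarization: the four kernels on the right come from the families `v + iˡ w`. -/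
theorem vectorKernel_eq_sum (v w : Z → E.carrier) :
    E.vectorKernel v w = ∑ l : Fin 4, ((-Complex.I) ^ (l : ℕ) / 4) •
      E.vectorKernel (v + Complex.I ^ (l : ℕ) • w) (v + Complex.I ^ (l : ℕ) • w) := by
  ext x y a
  have h : ∀ z : ℂ, E.vectorKernel (v + z • w) (v + z • w) x y a =
      E.ip (E.lact a (v y)) (v x) + z • E.ip (E.lact a (w y)) (v x) +
        (star z • E.ip (E.lact a (v y)) (w x) +
          star z • z • E.ip (E.lact a (w y)) (w x)) := fun z => by
    rw [vectorKernel_apply]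
    simp only [Pi.add_apply, Pi.smul_apply, map_add, map_smul, ip_add_left, ip_add_right,
      ip_complex_smul_left, ip_complex_smul_right, smul_add]
  rw [Finset.sum_apply, Finset.sum_apply, sum_apply]
  simp only [Pi.smul_apply, smul_apply, h, Fin.sum_univ_four, vectorKernel_apply]
  generalize E.ip (E.lact a (v y)) (v x) = b₁
  generalize E.ip (E.lact a (w y)) (v x) = b₂
  generalize E.ip (E.lact a (v y)) (w x) = b₃
  generalize E.ip (E.lact a (w y)) (w x) = b₄
  have h3 : (-Complex.I) ^ 3 = Complex.I := by rw [neg_pow, Complex.I_pow_three]; norm_num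
  simp [Complex.I_pow_three, h3]
  linear_combination (norm := module)
    ((1 / 2 : ℂ) • Complex.I_mul_I) • b₂ - ((1 / 2 : ℂ) • Complex.I_mul_I) • b₃

end Correspondence

end VectorKernel

/-! ### The `2 × 2` matrix of kernels -/

section Entries

variable {X A B : Type*} [CStarAlgebra A] [PartialOrder A] [StarOrderedRing A]
  [CStarAlgebra B] [PartialOrder B] [StarOrderedRing B]

/-- The four entries of the `2 × 2` matrix of kernels, as one kernel on `X × {0, 1}`. -/
noncomputable def entryKernel (L₁ L₂ k : Kernel X A B) : Kernel (X × Fin 2) A B := fun s t =>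
  !![L₁ s.1 t.1, k s.1 t.1; adjoint k s.1 t.1, L₂ s.1 t.1] s.2 t.2

theorem schurKernel_eq (L₁ L₂ k : Kernel X A B) :
    schurKernel L₁ L₂ k = fun x y =>
      schurMap (Matrix.of fun p q => entryKernel L₁ L₂ k (x, p) (y, q)) := rfl

/-- Complete positivity of the Schur product kernel is tested on the matrices `aᵢ` and `bᵢ` with all
entries of one row equal to the given element and the other row zero: row `0` for `aᵢ`, and for `bᵢ`
the row labelled by the second coordinate of the point. -/
theorem isCompletelyPositive_entryKernel {L₁ L₂ k : Kernel X A B}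
    (h : IsCompletelyPositive (schurKernel L₁ L₂ k)) :
    IsCompletelyPositive (entryKernel L₁ L₂ k) := by
  intro n y a b
  have h₁ := quad_nonneg (h n (fun i => (y i).1)
    (fun i => CStarMatrix.ofMatrix (Matrix.of fun t _ => if t = 0 then a i else 0))
    (fun i => CStarMatrix.ofMatrix (Matrix.of fun p _ => if p = (y i).2 then b i else 0)))
    (Pi.single 0 1)
  simp only [map_sum, quad_star_mul_mul] at h₁
  refine h₁.trans_eq (Finset.sum_congr rfl fun i _ => Finset.sum_congr rfl fun j _ => ?_)
  -- Only the entry at the labels of `y i` and `y j` meets the supports of the two columns.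
  rw [Finset.sum_eq_single (y i).2, Finset.sum_eq_single (y j).2]
  · change star _ * entryKernel L₁ L₂ k (y i) (y j)
      (∑ t : Fin 2, star (if t = 0 then a i else 0) * (if t = 0 then a j else 0)) * _ = _
    simp [Fin.sum_univ_two]
  all_goals simp +contextual

end Entries

end CKernel

theorem mainTheorem4 {X : Type*} {A : Type*} {B : Type*}
    [CStarAlgebra A] [PartialOrder A] [StarOrderedRing A]
    [CStarAlgebra B] [PartialOrder B] [StarOrderedRing B]
    (k : CKernel.Kernel X A B) :
    (CKernel.HasKolmogorovDecomposition k ↔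
      ∃ L₁ L₂ : CKernel.Kernel X A B,
        CKernel.IsCompletelyPositive L₁ ∧ CKernel.IsCompletelyPositive L₂ ∧
          CKernel.IsCompletelyPositive (CKernel.schurKernel L₁ L₂ k)) ∧
    (CKernel.HasKolmogorovDecomposition k →
      CKernel.IsCompletelyBounded k ∧
        ∃ (c : Fin 4 → ℂ) (L : Fin 4 → CKernel.Kernel X A B),
          (∀ i, CKernel.IsCompletelyPositive (L i)) ∧ k = ∑ i, c i • L i) := by
  refine ⟨⟨?_, ?_⟩, ?_⟩
  · rintro ⟨E, J, ι, -, -, -, hk⟩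
    obtain rfl : k = E.vectorKernel (fun x => J (ι x)) ι := by
      ext x y a
      exact hk x y a
    -- The four corners are the vector kernels of the pair of families `J ∘ ι` and `ι`.
    let v (s : X × Fin 2) : E.carrier := ![J (ι s.1), ι s.1] s.2
    refine ⟨E.vectorKernel (fun x => J (ι x)) fun x => J (ι x), E.vectorKernel ι ι,
      E.isCompletelyPositive_vectorKernel _, E.isCompletelyPositive_vectorKernel _, ?_⟩
    have h : CKernel.entryKernel (E.vectorKernel (fun x => J (ι x)) fun x => J (ι x))
        (E.vectorKernel ι ι) (E.vectorKernel (fun x => J (ι x)) ι) = E.vectorKernel v v := by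
      funext s t
      obtain ⟨x, p⟩ := s
      obtain ⟨y, q⟩ := t
      simp only [CKernel.entryKernel, E.adjoint_vectorKernel]
      fin_cases p <;> fin_cases q <;> rfl
    rw [CKernel.schurKernel_eq, h]
    exact (E.isCompletelyPositive_vectorKernel v).schur fun x p => (x, p)
  · rintro ⟨L₁, L₂, -, -, h⟩
    exact (CKernel.isCompletelyPositive_entryKernel h).hasKolmogorovDecomposition_corner
  · rintro ⟨E, J, ι, -, -, -, hk⟩
    obtain rfl : k = E.vectorKernel (fun x => J (ι x)) ι := by
      ext x y a
      exact hk x y a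
    rw [E.vectorKernel_eq_sum]
    exact ⟨CKernel.isCompletelyBounded_sum_smul
      (fun l => E.isCompletelyPositive_vectorKernel _) _, _, _,
      fun l => E.isCompletelyPositive_vectorKernel _, rfl⟩
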